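/- For integers $n\ge 1$ and $k\ge 0$, let $|\psi_j\rangle=\cos\left(\frac{\pi j}{n}\right)|0\rangle+\sin\left(\frac{\pi j}{n}\right)|1\rangle\in\mathbb C^2$, $j=1,\dots,n$, be the $n$ cyclic geometrically uniform (CGU) qubit states, and put $\varrho_j=|\psi_j\rangle\langle\psi_j|$ and $\varrho^{(k)}_n=\frac1n\sum_{j=1}^n\varrho_j^{\otimes k}$. Let $$P_{CGU}(n,k)=\sup_{M}\ \frac1n\sum_{j=1}^n\operatorname{tr}\left[\varrho_j^{\otimes k}M_j\right]$$ be the optimal success probability of discriminating $k$ copies of these states with equal prior probabilities, where the supremum is over all $n$-outcome measurements on $(\mathbb C^2)^{\otimes k}$, i.e. all families $M=(M_1,\dots,M_n)$ of positive semidefinite operators with $\sum_{j=1}^n M_j=\mathbb 1$. Proposition. There are operators $\varrho^{(k)}$ on $(\mathbb C^2)^{\otimes k}$ and real numbers $f(k)=\left(\operatorname{tr}\sqrt{\varrho^{(k)}}\right)^2$, both depending only on $k$, such that for all $n>k\ge 0$: $\varrho^{(k)}_n=\varrho^{(k)}$, the supremum defining $P_{CGU}(n,k)$ is attained, and $$P_{CGU}(n,k)=\frac{f(k)}{n}.$$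 -/

import Mathlib

open scoped Matrix ComplexOrder MatrixOrder

noncomputable section

namespace MultiCopy

/-- A measurement with `n` outcomes on the system `ℂ^d` (a POVM): positive semidefinite effects
that sum up to the identity. -/
structure POVM (n : ℕ) (d : Type) [Fintype d] [DecidableEq d] where
  /-- the effect of each outcome -/
  effect : Fin n → Matrix d d ℂ
  effect_posSemidef : ∀ i, (effect i).PosSemidef
  sum_effect : ∑ i, effect i = 1

/-- Average success probability `(1/n) ∑ i, tr (ϱ i * M i)` of discriminating the equiprobable
states `ϱ i` by the measurement `M`. (The trace is a real number when the `ϱ i` are positive.) -/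
def successProb {n : ℕ} {d : Type} [Fintype d] [DecidableEq d]
    (ϱ : Fin n → Matrix d d ℂ) (M : POVM n d) : ℝ :=
  (1 / (n : ℝ)) * ∑ i, ((ϱ i * M.effect i).trace).re

/-- The success probabilities that are attained by some `n`-outcome measurement. -/
def attainableProbs {n : ℕ} {d : Type} [Fintype d] [DecidableEq d]
    (ϱ : Fin n → Matrix d d ℂ) : Set ℝ :=
  Set.range (successProb ϱ)

/-- Optimal success probability: the supremum over all `n`-outcome measurements. -/
def optimalProb {n : ℕ} {d : Type} [Fintype d] [DecidableEq d]
    (ϱ : Fin n → Matrix d d ℂ) : ℝ :=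
  sSup (attainableProbs ϱ)

/-- The `k`-fold tensor (Kronecker) power of an operator on `ℂ^d`, as a matrix with respect to the
product basis, which is indexed by the words of length `k`. -/
def tensorPow {d : Type} (k : ℕ) (ϱ : Matrix d d ℂ) : Matrix (Fin k → d) (Fin k → d) ℂ :=
  Matrix.of fun x y => ∏ a, ϱ (x a) (y a)

/-- The cyclic geometrically uniform state vectors
`ψ_j = cos (π j / n) |0⟩ + sin (π j / n) |1⟩`, `j = 1, …, n`; the index `i : Fin n` stands for the
label `j = i + 1`. -/
def cguVec (n : ℕ) (i : Fin n) : Fin 2 → ℂ :=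
  ![(Real.cos (Real.pi * ((i : ℕ) + 1) / n) : ℂ), (Real.sin (Real.pi * ((i : ℕ) + 1) / n) : ℂ)]

/-- The density matrix `|ψ_j⟩⟨ψ_j|` of a cyclic geometrically uniform state. -/
def cguState (n : ℕ) (i : Fin n) : Matrix (Fin 2) (Fin 2) ℂ :=
  Matrix.vecMulVec (cguVec n i) (star (cguVec n i))

/-- The ensemble of `k` copies of the `n` cyclic geometrically uniform states. -/
def cguCopies (n k : ℕ) (i : Fin n) : Matrix (Fin k → Fin 2) (Fin k → Fin 2) ℂ :=
  tensorPow k (cguState n i)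

/-- The average state `ϱ^(k) = (1/n) ∑ i, |ψ_i⟩⟨ψ_i|^{⊗ k}` of that ensemble. -/
def cguAverage (n k : ℕ) : Matrix (Fin k → Fin 2) (Fin k → Fin 2) ℂ :=
  (1 / (n : ℂ)) • ∑ i, cguCopies n k i

/-- `P_CGU(n, k)`: the optimal success probability, over all (global) measurements on the `k`
copies, of discriminating `k` copies of the `n` cyclic geometrically uniform states. -/
def probCGU (n k : ℕ) : ℝ :=
  optimalProb (cguCopies n k)

/-- The positive square root of a positive semidefinite matrix. -/
def matSqrt {d : Type} [Fintype d] [DecidableEq d] (A : Matrix d d ℂ) : Matrix d d ℂ :=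
  CFC.sqrt A

end MultiCopy

end

/-! An entry of the `k`-copy state at angle `θ` is a homogeneous polynomial of degree `2k` in `cos
θ`, `sin θ`, so only the frequencies `exp (2imθ)` with `|m| ≤ k` occur. Averaging over `n > k`
equidistant angles kills all of them but `m = 0` (`sum_cos_pow_mul_sin_pow`). The average `ρ` thus
depends neither on `n` nor on an offset of the angles, and it commutes with the rotations
(`commute_cguAverage_rot`).

Put `A = √ρ`, `t = tr A`, and let `B` be a generalized inverse of `A`. By symmetry the overlaps `tr
(B E_j)` agree, hence equal their mean `tr (B ρ) = t`. The pretty good measurement `B E_j B / n`,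
completed off the support, then succeeds with probability `t² / n`. Conversely `E_j ≤ t A`, so every
measurement has `∑ tr (E_j M_j) ≤ t tr A = t²` (`isGreatest_attainableProbs`). -/

open scoped Matrix ComplexOrder MatrixOrder
namespace MultiCopy

/-! ### Optimality of the pretty good measurement -/

section PrettyGood

variable {d : Type} [Fintype d]

/-- The operator of rank at most one `E` absorbs everything between two copies of it. -/
def IsRankOneLike (E : Matrix d d ℂ) : Prop :=
  ∀ X, E * X * E = (X * E).trace • E

theorem isRankOneLike_vecMulVec (v w : d → ℂ) : IsRankOneLike (Matrix.vecMulVec v w) := by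
  intro X
  rw [mul_assoc, Matrix.mul_vecMulVec, Matrix.vecMulVec_mul_vecMulVec, Matrix.trace_vecMulVec]
  rw [dotProduct_comm, Matrix.vecMulVec_smul]

variable [DecidableEq d]

/-- A positive semidefinite matrix has a Hermitian generalized inverse, which commutes with it and
with everything the matrix commutes with. -/
theorem exists_pseudoInverse {A : Matrix d d ℂ} (hA : A.PosSemidef) :
    ∃ B : Matrix d d ℂ, B.IsHermitian ∧ A * B = B * A ∧ A * B * A = A ∧
      ∀ U, Commute A U → Commute B U := by
  have hs : IsSelfAdjoint A := hA.isHermitian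
  have hcont : ∀ f : ℝ → ℝ, ContinuousOn f (spectrum ℝ A) := fun f =>
    (Matrix.finite_real_spectrum (A := A)).continuousOn f
  have hid : cfc (fun x : ℝ => x) A = A := cfc_id' ℝ A
  have hmul : ∀ f g : ℝ → ℝ, cfc f A * cfc g A = cfc (fun x => f x * g x) A := fun f g =>
    (cfc_mul f g A (hcont f) (hcont g)).symm
  have hl : A * cfc (fun x : ℝ => x⁻¹) A = cfc (fun x : ℝ => x * x⁻¹) A := by
    simpa only [hid] using hmul (fun x => x) fun x => x⁻¹
  have hr : cfc (fun x : ℝ => x⁻¹) A * A = cfc (fun x : ℝ => x⁻¹ * x) A := by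
    simpa only [hid] using hmul (fun x => x⁻¹) fun x => x
  -- The convention `0⁻¹ = 0` makes this the inverse on the support and zero on the kernel.
  refine ⟨cfc (fun x : ℝ => x⁻¹) A, cfc_predicate _ A, ?_, ?_, fun U hU => hU.cfc_real _⟩
  · rw [hl, hr]
    simp only [mul_comm]
  · have h := hmul (fun x => x * x⁻¹) fun x => x
    simp only [hid, mul_inv_mul_cancel] at h
    rw [hl, h]

theorem trace_mul_nonneg_of_posSemidef {A B : Matrix d d ℂ} (hA : A.PosSemidef)
    (hB : B.PosSemidef) : 0 ≤ (A * B).trace := by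
  have h : CFC.sqrt B * CFC.sqrt B = B := CFC.sqrt_mul_sqrt_self B hB.nonneg
  have hs : (CFC.sqrt B)ᴴ = CFC.sqrt B :=
    (Matrix.nonneg_iff_posSemidef.mp (CFC.sqrt_nonneg B)).isHermitian
  rw [← h, ← mul_assoc, Matrix.trace_mul_comm, ← mul_assoc]
  simpa [hs] using (hA.conjTranspose_mul_mul_same (CFC.sqrt B)).trace_nonneg

/-- An equiprobable ensemble `E` of rank one operators whose average commutes with unitaries that
carry a fixed operator to the `E j` is discriminated optimally by the pretty good measurement. -/
theorem isGreatest_attainableProbs {n : ℕ} (hn : 0 < n) (E : Fin n → Matrix d d ℂ)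
    (F : Matrix d d ℂ) (U : Fin n → Matrix d d ℂ) (hE : ∀ j, (E j).PosSemidef)
    (hrank : ∀ j, IsRankOneLike (E j)) (hU : ∀ j, (U j)ᴴ * U j = 1)
    (hUE : ∀ j, E j = U j * F * (U j)ᴴ)
    (ρ : Matrix d d ℂ) (hρ : ρ = (1 / (n : ℂ)) • ∑ j, E j) (hcomm : ∀ j, Commute ρ (U j)) :
    IsGreatest (attainableProbs E) ((matSqrt ρ).trace.re ^ 2 / n) := by
  have hn0 : (n : ℂ) ≠ 0 := by exact_mod_cast hn.ne'
  have hn1 : (0 : ℂ) ≤ 1 / (n : ℂ) := by positivity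
  have hρp : ρ.PosSemidef := by
    rw [hρ]
    exact (Matrix.posSemidef_sum _ fun j _ => hE j).smul hn1
  have hAp : (matSqrt ρ).PosSemidef := Matrix.nonneg_iff_posSemidef.mp (CFC.sqrt_nonneg ρ)
  have hAA : matSqrt ρ * matSqrt ρ = ρ := CFC.sqrt_mul_sqrt_self ρ hρp.nonneg
  have hAU : ∀ j, Commute (matSqrt ρ) (U j) := by
    intro j
    rw [matSqrt, CFC.sqrt_eq_cfc]
    exact (hcomm j).cfc_nnreal _
  set A := matSqrt ρ with hAdef
  obtain ⟨B, hBh, hAB, hABA, hBcomm⟩ := exists_pseudoInverse hAp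
  have hBU : ∀ j, Commute B (U j) := fun j => hBcomm _ (hAU j)
  have hAh : Aᴴ = A := hAp.isHermitian
  have hBh' : Bᴴ = B := hBh
  have hEh : ∀ j, (E j)ᴴ = E j := fun j => (hE j).isHermitian
  -- the complement of the support projection
  set Q : Matrix d d ℂ := 1 - A * B with hQ
  have hQh : Qᴴ = Q := by
    simp [hQ, Matrix.conjTranspose_mul, hAh, hBh', hAB]
  have hQA : Q * A = 0 := by rw [hQ, sub_mul, hABA, one_mul, sub_self]
  have hQQ : Q * Q = Q := by
    nth_rw 2 [hQ]
    rw [mul_sub, ← mul_assoc, hQA]; simp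
  have hQE : ∀ j, Q * E j = 0 := by
    have hsum : ∑ j, (Q * E j * Qᴴ) = 0 := by
      have h1 : Q * ρ * Qᴴ = 0 := by rw [← hAA, ← mul_assoc, hQA]; simp
      rw [hρ] at h1
      have h2 : (1 / (n : ℂ)) • ∑ j, (Q * E j * Qᴴ) = 0 := by
        rw [← h1]; simp [Matrix.mul_sum, Matrix.sum_mul]
      exact (smul_eq_zero.mp h2).resolve_left (by simpa using hn.ne')
    have hz : ∀ j, Q * E j * Qᴴ = 0 := by
      intro j
      have h := (Finset.sum_eq_zero_iff_of_nonneg (fun i _ =>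
        ((hE i).mul_mul_conjTranspose_same Q).nonneg)).mp hsum
      exact h j (Finset.mem_univ j)
    intro j
    -- By rank one, `(Q E)(Q E)ᴴ = Q E E Qᴴ` is a multiple of `Q E Qᴴ = 0`.
    rw [← Matrix.self_mul_conjTranspose_eq_zero, Matrix.conjTranspose_mul, hEh,
      mul_assoc, ← mul_assoc (E j)]
    have h := hrank j 1
    rw [mul_one] at h
    rw [h]
    simp only [Matrix.smul_mul, Matrix.mul_smul, ← mul_assoc, hz, smul_zero]
  have hPE : ∀ j, A * B * E j = E j := by
    intro j
    have h := hQE j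
    rw [hQ, sub_mul, one_mul, sub_eq_zero] at h
    exact h.symm
  have hEP : ∀ j, E j * (B * A) = E j := by
    intro j
    have h := congrArg Matrix.conjTranspose (hPE j)
    simpa [Matrix.conjTranspose_mul, hAh, hBh', hEh] using h
  -- the overlaps
  have hτ : ∀ j, (B * E j).trace = (B * F).trace := by
    intro j
    rw [hUE, ← mul_assoc, ← mul_assoc, (hBU j).eq, Matrix.trace_mul_comm, ← mul_assoc, ← mul_assoc,
      hU, one_mul]
  have hBρ : B * ρ = A := by rw [← hAA, ← mul_assoc, ← hAB, hABA]
  have ht : ∀ j, (B * E j).trace = A.trace := by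
    intro j
    rw [hτ, ← hBρ, hρ]
    simp only [Matrix.mul_smul, Matrix.mul_sum, Matrix.trace_smul, Matrix.trace_sum, hτ,
      Finset.sum_const, Finset.card_univ, Fintype.card_fin, smul_eq_mul, nsmul_eq_mul]
    field_simp
  have htpos : 0 ≤ A.trace := hAp.trace_nonneg
  have htre : ((A.trace.re : ℝ) : ℂ) = A.trace := by
    exact (Complex.eq_re_of_ofReal_le (r := 0) (by simpa using htpos)).symm
  have hEBE : ∀ j, E j * B * E j = A.trace • E j := fun j => by rw [hrank j B, ht]
  constructor
  · let j₀ : Fin n := ⟨0, hn⟩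
    -- The effects `B E_j B / n` sum only to the support projection; assigning `Q` to one outcome
    -- completes them and costs nothing, since `E_j Q = 0`.
    refine ⟨⟨fun j => (1 / (n : ℂ)) • (B * E j * B) + if j = j₀ then Q else 0, ?_, ?_⟩, ?_⟩
    · intro j
      refine Matrix.PosSemidef.add (Matrix.PosSemidef.smul ?_ hn1) ?_
      · simpa [hBh'] using (hE j).mul_mul_conjTranspose_same B
      · split_ifs
        · rw [← hQQ]
          nth_rw 2 [← hQh]
          exact Matrix.posSemidef_self_mul_conjTranspose Q
        · exact Matrix.PosSemidef.zero
    · rw [Finset.sum_add_distrib, ← Finset.smul_sum, ← Matrix.sum_mul, ← Matrix.mul_sum,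
        Finset.sum_ite_eq' Finset.univ j₀ fun _ => Q, if_pos (Finset.mem_univ _),
        ← Matrix.smul_mul, ← Matrix.mul_smul, ← hρ, hBρ, hQ]
      abel
    · have hterm : ∀ j, (E j * ((1 / (n : ℂ)) • (B * E j * B) + if j = j₀ then Q else 0)).trace
          = ((A.trace.re ^ 2 / n : ℝ) : ℂ) := by
        intro j
        have h1 : E j * (if j = j₀ then Q else 0) = 0 := by
          split_ifs
          · simpa [hQh, hEh] using congrArg Matrix.conjTranspose (hQE j)
          · simp
        rw [mul_add, h1, add_zero, Matrix.mul_smul, ← mul_assoc, ← mul_assoc, hEBE,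
          Matrix.smul_mul, Matrix.trace_smul, Matrix.trace_smul, Matrix.trace_mul_comm, ht]
        push_cast
        rw [htre, smul_eq_mul, smul_eq_mul]
        ring
      simp only [successProb, hterm, Complex.ofReal_re, Finset.sum_const, Finset.card_univ,
        Fintype.card_fin, nsmul_eq_mul]
      have : (n : ℝ) ≠ 0 := by exact_mod_cast hn.ne'
      field_simp
  · rintro _ ⟨M, rfl⟩
    -- Dual certificate: `t A` dominates every state. Up to the factor `t`, the difference is `(t -
    -- E B) A (t - E B)ᴴ`; the case `t = 0`, where one cannot divide, is trivial.
    have hle : ∀ j, (A.trace • A - E j).PosSemidef := by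
      intro j
      rcases htpos.eq_or_lt with h0 | hpos
      · have hA0 : A = 0 := hAp.trace_eq_zero_iff.mp h0.symm
        have hE0 : E j = 0 := by rw [← hPE j, hA0]; simp
        simp [hA0, hE0, Matrix.PosSemidef.zero]
      · have h := hAp.mul_mul_conjTranspose_same (A.trace • 1 - E j * B)
        have hst : star A.trace = A.trace := by
          rw [← htre]; simp
        have hx : (A.trace • 1 - E j * B) * A * (A.trace • 1 - E j * B)ᴴ
            = A.trace • (A.trace • A - E j) := by
          have e1 : E j * B * A = E j := by rw [mul_assoc, hEP]
          have e2 : A * (B * E j) = E j := by rw [← mul_assoc, hPE]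
          rw [Matrix.conjTranspose_sub, Matrix.conjTranspose_smul, Matrix.conjTranspose_one,
            Matrix.conjTranspose_mul, hBh', hEh, hst, sub_mul, e1, sub_mul, mul_sub, mul_sub,
            Matrix.smul_mul, Matrix.smul_mul, Matrix.smul_mul, one_mul, e2, ← mul_assoc, hEBE,
            Matrix.mul_smul, Matrix.mul_smul, mul_one, mul_one, smul_sub]
          abel
        rw [hx] at h
        have h2 := h.smul (inv_nonneg.mpr htpos)
        rwa [smul_smul, inv_mul_cancel₀ hpos.ne', one_smul] at h2
    have hb : ∀ j, ((E j * M.effect j).trace).re ≤ ((A.trace • (A * M.effect j)).trace).re := by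
      intro j
      have h := trace_mul_nonneg_of_posSemidef (hle j) (M.effect_posSemidef j)
      rw [sub_mul, Matrix.trace_sub, Matrix.smul_mul] at h
      have := (Complex.le_def.mp h).1
      simpa using this
    have hs : ∑ j, ((A.trace • (A * M.effect j)).trace).re = A.trace.re ^ 2 := by
      rw [← Complex.re_sum, ← Matrix.trace_sum, ← Finset.smul_sum, ← Matrix.mul_sum, M.sum_effect,
        mul_one, Matrix.trace_smul, smul_eq_mul, ← htre, ← Complex.ofReal_mul, Complex.ofReal_re]
      simp [sq]
    have e : A.trace.re ^ 2 / n = 1 / (n : ℝ) * A.trace.re ^ 2 := by ring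
    rw [successProb, e]
    exact mul_le_mul_of_nonneg_left ((Finset.sum_le_sum fun j _ => hb j).trans hs.le)
      (by positivity)

end PrettyGood

end MultiCopy
namespace MultiCopy

/-! ### Tensor powers and rotations -/

section Tensor

variable {d : Type}

theorem tensorPow_mul [Fintype d] (k : ℕ) (A B : Matrix d d ℂ) :
    tensorPow k (A * B) = tensorPow k A * tensorPow k B := by
  ext x y
  simp only [tensorPow, Matrix.of_apply, Matrix.mul_apply, ← Finset.prod_mul_distrib]
  rw [Finset.prod_univ_sum, Fintype.piFinset_univ]

theorem tensorPow_one [DecidableEq d] (k : ℕ) : tensorPow k (1 : Matrix d d ℂ) = 1 := by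
  ext x y
  simp only [tensorPow, Matrix.of_apply, Matrix.one_apply, Finset.prod_ite_zero,
    Finset.prod_const_one, Finset.mem_univ, true_imp_iff, funext_iff]

theorem tensorPow_conjTranspose (k : ℕ) (A : Matrix d d ℂ) :
    tensorPow k Aᴴ = (tensorPow k A)ᴴ := by
  ext x y
  simp [tensorPow, Matrix.conjTranspose_apply]

theorem tensorPow_vecMulVec (k : ℕ) (v w : d → ℂ) :
    tensorPow k (Matrix.vecMulVec v w) =
      Matrix.vecMulVec (fun x : Fin k → d => ∏ a, v (x a)) (fun x => ∏ a, w (x a)) := by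
  ext x y
  simp [tensorPow, Matrix.vecMulVec_apply, Finset.prod_mul_distrib]

end Tensor

/-- The rotation of the plane by the angle `θ`, as a complex matrix. -/
noncomputable def rot (θ : ℝ) : Matrix (Fin 2) (Fin 2) ℂ :=
  !![(Real.cos θ : ℂ), -(Real.sin θ : ℂ); (Real.sin θ : ℂ), (Real.cos θ : ℂ)]

theorem rot_conjTranspose_mul_self (θ : ℝ) : (rot θ)ᴴ * rot θ = 1 := by
  have h : (Real.cos θ : ℂ) * Real.cos θ + Real.sin θ * Real.sin θ = 1 := by
    rw [← sq, ← sq]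
    exact_mod_cast Real.cos_sq_add_sin_sq θ
  ext i j
  fin_cases i <;> fin_cases j <;>
    simp [rot, Matrix.mul_apply, Fin.sum_univ_two, -Complex.ofReal_cos, -Complex.ofReal_sin] <;>
    first | ring1 | linear_combination h

/-- The real unit vector at the angle `θ`. -/
noncomputable def angleVec (θ : ℝ) : Fin 2 → ℂ := ![(Real.cos θ : ℂ), (Real.sin θ : ℂ)]

theorem star_angleVec (θ : ℝ) : star (angleVec θ) = angleVec θ := by
  ext i
  fin_cases i <;> simp [angleVec, -Complex.ofReal_cos, -Complex.ofReal_sin]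

/-- The projection onto the real unit vector at the angle `θ`. -/
noncomputable def angleState (θ : ℝ) : Matrix (Fin 2) (Fin 2) ℂ :=
  Matrix.vecMulVec (angleVec θ) (star (angleVec θ))

theorem rot_mulVec_angleVec (φ θ : ℝ) : rot φ *ᵥ angleVec θ = angleVec (φ + θ) := by
  ext i
  fin_cases i
  all_goals
    simp [rot, angleVec, Real.cos_add, Real.sin_add, Matrix.mulVec, dotProduct, Fin.sum_univ_two,
      -Complex.ofReal_cos, -Complex.ofReal_sin]
  ring

theorem rot_mul_angleState_mul (φ θ : ℝ) :
    rot φ * angleState θ * (rot φ)ᴴ = angleState (φ + θ) := by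
  rw [angleState, Matrix.mul_vecMulVec, Matrix.vecMulVec_mul, ← Matrix.star_mulVec,
    rot_mulVec_angleVec, angleState]

theorem tensorPow_rot_mul (k : ℕ) (φ θ : ℝ) :
    tensorPow k (rot φ) * tensorPow k (angleState θ) * (tensorPow k (rot φ))ᴴ =
      tensorPow k (angleState (φ + θ)) := by
  rw [← tensorPow_conjTranspose, ← tensorPow_mul, ← tensorPow_mul, rot_mul_angleState_mul]

theorem cguCopies_eq (n k : ℕ) (i : Fin n) :
    cguCopies n k i = tensorPow k (angleState (Real.pi * ((i : ℕ) + 1) / n)) := rfl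

/-! ### Averages of trigonometric polynomials over equidistant angles -/

section Average

open Polynomial

/-- A polynomial `P` with `cos θ ^ b * sin θ ^ a = w ^ (-(a + b) / 2) * P w`, `w = exp (2 i θ)`. -/
noncomputable def trigPoly (b a : ℕ) : ℂ[X] :=
  (C (1 / 2) * (X + C 1)) ^ b * (C (1 / (2 * Complex.I)) * (X + C (-1))) ^ a

theorem natDegree_trigPoly_le (b a : ℕ) : (trigPoly b a).natDegree ≤ b + a := by
  have h : ∀ c e : ℂ, (C c * (X + C e)).natDegree ≤ 1 := fun c e =>
    (natDegree_C_mul_le _ _).trans (natDegree_X_add_C e).le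
  refine natDegree_mul_le.trans (add_le_add ?_ ?_)
  · simpa using natDegree_pow_le_of_le b (h (1 / 2) 1)
  · simpa using natDegree_pow_le_of_le a (h (1 / (2 * Complex.I)) (-1))

/-- One factor `exp (iθ)` per cosine or sine turns it into `(w + 1) / 2` or `(w - 1) / (2i)`, where
`w = exp (2iθ)`. -/
theorem exp_mul_cos_pow_mul_sin_pow (b a : ℕ) (θ : ℝ) :
    Complex.exp (θ * Complex.I) ^ (b + a) * ((Real.cos θ : ℂ) ^ b * (Real.sin θ : ℂ) ^ a) =
      (trigPoly b a).eval (Complex.exp (θ * Complex.I) ^ 2) := by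
  have h1 : (Real.cos θ : ℂ) ^ 2 + (Real.sin θ : ℂ) ^ 2 = 1 := by
    exact_mod_cast Real.cos_sq_add_sin_sq θ
  have hI := Complex.I_sq
  have hz : Complex.exp (θ * Complex.I) = Real.cos θ + Real.sin θ * Complex.I := by
    rw [Complex.exp_mul_I, Complex.ofReal_cos, Complex.ofReal_sin]
  have hc : Complex.exp (θ * Complex.I) * Real.cos θ =
      1 / 2 * (Complex.exp (θ * Complex.I) ^ 2 + 1) := by
    rw [hz]
    linear_combination (1 / 2 : ℂ) * h1 - (1 / 2 : ℂ) * (Real.sin θ : ℂ) ^ 2 * hI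
  have hs : Complex.exp (θ * Complex.I) * Real.sin θ =
      1 / (2 * Complex.I) * (Complex.exp (θ * Complex.I) ^ 2 + -1) := by
    rw [hz]
    field_simp
    linear_combination -h1 + (Real.sin θ : ℂ) ^ 2 * hI
  simp only [trigPoly, eval_mul, eval_pow, eval_C, eval_add, eval_X]
  rw [← hc, ← hs]
  ring

/-- The quotient stands for `ζ ^ (l - m)` with a possibly negative exponent. As `0 < |l - m| < n`,
it is an `n`-th root of unity other than `1`, and the geometric sum vanishes. -/
theorem sum_pow_eq_zero {n : ℕ} {ζ : ℂ} (hζ : IsPrimitiveRoot ζ n) {l m : ℕ} (hlm : l ≠ m)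
    (hl : l < m + n) (hm : m < l + n) : ∑ j : Fin n, (ζ ^ l / ζ ^ m) ^ (j : ℕ) = 0 := by
  have hn : n ≠ 0 := by omega
  have hζ0 : ζ ≠ 0 := hζ.ne_zero hn
  have hne : ζ ^ l / ζ ^ m ≠ 1 := by
    intro h
    rw [div_eq_one_iff_eq (pow_ne_zero _ hζ0)] at h
    rcases lt_or_gt_of_ne hlm with hlt | hlt
    · have : ζ ^ (m - l) = 1 := by
        have := pow_sub₀ ζ hζ0 hlt.le
        rw [this, h, mul_inv_cancel₀ (pow_ne_zero _ hζ0)]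
      exact hζ.pow_ne_one_of_pos_of_lt (by omega) (by omega) this
    · have : ζ ^ (l - m) = 1 := by
        have := pow_sub₀ ζ hζ0 hlt.le
        rw [this, h, mul_inv_cancel₀ (pow_ne_zero _ hζ0)]
      exact hζ.pow_ne_one_of_pos_of_lt (by omega) (by omega) this
  rw [Fin.sum_univ_eq_sum_range fun j => (ζ ^ l / ζ ^ m) ^ j, geom_sum_eq hne, div_pow, ← pow_mul,
    ← pow_mul, mul_comm l, mul_comm m, pow_mul, pow_mul, hζ.pow_eq_one]
  simp

/-- The average of a trigonometric polynomial of degree `2 k` over `n > k` equidistant angles is its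
constant Fourier coefficient. -/
theorem sum_cos_pow_mul_sin_pow {n k b a : ℕ} (hk : k < n) (hab : b + a = 2 * k) (φ : ℝ) :
    ∑ j : Fin n, (Real.cos (φ + Real.pi * ((j : ℕ) + 1) / n) : ℂ) ^ b *
        (Real.sin (φ + Real.pi * ((j : ℕ) + 1) / n) : ℂ) ^ a =
      n * (trigPoly b a).coeff k := by
  have hn : n ≠ 0 := by omega
  set P := trigPoly b a
  set ζ : ℂ := Complex.exp (2 * Real.pi * Complex.I / n)
  have hζ : IsPrimitiveRoot ζ n := Complex.isPrimitiveRoot_exp n hn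
  set c : ℂ := Complex.exp (2 * φ * Complex.I) * ζ
  have hc0 : c ≠ 0 := mul_ne_zero (Complex.exp_ne_zero _) (Complex.exp_ne_zero _)
  have hζ0 : ζ ≠ 0 := Complex.exp_ne_zero _
  have hw : ∀ j : Fin n, Complex.exp ((φ + Real.pi * ((j : ℕ) + 1) / n : ℝ) * Complex.I) ^ 2 =
      c * ζ ^ (j : ℕ) := by
    intro j
    simp only [c, ζ]
    rw [← Complex.exp_nat_mul, ← Complex.exp_nat_mul, ← Complex.exp_add, ← Complex.exp_add]
    congr 1
    push_cast
    field_simp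
    ring
  clear_value c
  have hterm : ∀ j : Fin n, (Real.cos (φ + Real.pi * ((j : ℕ) + 1) / n) : ℂ) ^ b *
        (Real.sin (φ + Real.pi * ((j : ℕ) + 1) / n) : ℂ) ^ a =
      ∑ l ∈ Finset.range (2 * k + 1), P.coeff l * (c ^ l / c ^ k) * (ζ ^ l / ζ ^ k) ^ (j : ℕ) := by
    intro j
    have h := exp_mul_cos_pow_mul_sin_pow b a (φ + Real.pi * ((j : ℕ) + 1) / n)
    rw [hab, pow_mul, hw, eval_eq_sum_range' (n := 2 * k + 1)
      (by have := natDegree_trigPoly_le b a; omega)] at h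
    have h0 : (c * ζ ^ (j : ℕ)) ^ k ≠ 0 := pow_ne_zero _ (mul_ne_zero hc0 (pow_ne_zero _ hζ0))
    rw [eq_comm, ← mul_right_inj' h0, h, Finset.mul_sum]
    refine Finset.sum_congr rfl fun l _ => ?_
    have hk0 : c ^ k ≠ 0 := pow_ne_zero _ hc0
    have hk1 : (ζ ^ (j : ℕ)) ^ k ≠ 0 := pow_ne_zero _ (pow_ne_zero _ hζ0)
    rw [div_pow, mul_pow, mul_pow, pow_right_comm ζ k, pow_right_comm ζ l]
    generalize c ^ k = u at hk0 ⊢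
    generalize (ζ ^ (j : ℕ)) ^ k = v at hk1 ⊢
    field_simp
    rfl
  rw [Finset.sum_congr rfl fun j _ => hterm j, Finset.sum_comm]
  simp only [← Finset.mul_sum]
  rw [Finset.sum_eq_single k]
  · rw [div_self (pow_ne_zero _ hc0), div_self (pow_ne_zero _ hζ0)]
    simp [mul_comm]
  · intro l hl hlk
    rw [Finset.mem_range] at hl
    rw [sum_pow_eq_zero hζ hlk (by omega) (by omega), mul_zero]
  · intro h
    exact absurd (Finset.mem_range.mpr (by omega)) h

end Average

/-- The exponents count the letters `0` and `1` of the word, so they do not depend on the angle. -/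
theorem prod_angleVec_eq {k : ℕ} (x : Fin k → Fin 2) :
    ∃ b a : ℕ, b + a = k ∧
      ∀ θ, ∏ i, angleVec θ (x i) = (Real.cos θ : ℂ) ^ b * (Real.sin θ : ℂ) ^ a := by
  induction k with
  | zero => exact ⟨0, 0, rfl, fun θ => by simp⟩
  | succ k ih =>
    obtain ⟨b, a, hab, h⟩ := ih fun i => x i.succ
    rcases Fin.exists_fin_two.mp ⟨x 0, rfl⟩ with h0 | h0
    · refine ⟨b + 1, a, by omega, fun θ => ?_⟩
      rw [Fin.prod_univ_succ, h, h0]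
      simp only [angleVec, Matrix.cons_val_zero]
      ring
    · refine ⟨b, a + 1, by omega, fun θ => ?_⟩
      rw [Fin.prod_univ_succ, h, h0]
      simp only [angleVec, Matrix.cons_val_one, Matrix.cons_val_fin_one]
      ring

/-- The average of `k` copies of the states at `n > k` equidistant angles does not depend on `n` and
the offset. -/
theorem exists_average_eq (k : ℕ) :
    ∃ ϱ : Matrix (Fin k → Fin 2) (Fin k → Fin 2) ℂ, ∀ n, k < n → ∀ φ : ℝ,
      (1 / (n : ℂ)) • ∑ j : Fin n,
        tensorPow k (angleState (φ + Real.pi * ((j : ℕ) + 1) / n)) = ϱ := by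
  choose b a hab h using fun x : Fin k → Fin 2 => prod_angleVec_eq x
  refine ⟨Matrix.of fun x y => (trigPoly (b x + b y) (a x + a y)).coeff k, fun n hn φ => ?_⟩
  have hn0 : (n : ℂ) ≠ 0 := by exact_mod_cast (by omega : n ≠ 0)
  ext x y
  have hxy : b x + b y + (a x + a y) = 2 * k := by
    have := hab x
    have := hab y
    omega
  have hentry : ∀ θ : ℝ, tensorPow k (angleState θ) x y =
      (Real.cos θ : ℂ) ^ (b x + b y) * (Real.sin θ : ℂ) ^ (a x + a y) := by
    intro θ
    rw [angleState, star_angleVec, tensorPow_vecMulVec, Matrix.vecMulVec_apply, h, h]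
    ring
  simp only [Matrix.smul_apply, Matrix.sum_apply, hentry, Matrix.of_apply, smul_eq_mul]
  rw [sum_cos_pow_mul_sin_pow hn hxy]
  field_simp

end MultiCopy
-- Application to the CGU states
namespace MultiCopy

theorem cguAverage_eq (n k : ℕ) : cguAverage n k = (1 / (n : ℂ)) • ∑ j : Fin n,
    tensorPow k (angleState (0 + Real.pi * ((j : ℕ) + 1) / n)) := by
  simp only [zero_add]
  rfl

theorem cguAverage_eq_of_lt {n m k : ℕ} (hn : k < n) (hm : k < m) :
    cguAverage n k = cguAverage m k := by
  obtain ⟨ϱ, h⟩ := exists_average_eq k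
  rw [cguAverage_eq, cguAverage_eq, h n hn, h m hm]

theorem tensorPow_rot_conjTranspose_mul_self (k : ℕ) (φ : ℝ) :
    (tensorPow k (rot φ))ᴴ * tensorPow k (rot φ) = 1 := by
  rw [← tensorPow_conjTranspose, ← tensorPow_mul, rot_conjTranspose_mul_self, tensorPow_one]

/-- Conjugation by the rotation shifts all angles by `φ`, and the average ignores the offset. -/
theorem commute_cguAverage_rot {n k : ℕ} (hn : k < n) (φ : ℝ) :
    Commute (cguAverage n k) (tensorPow k (rot φ)) := by
  have hconj : tensorPow k (rot φ) * cguAverage n k * (tensorPow k (rot φ))ᴴ = cguAverage n k := by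
    obtain ⟨ϱ, h⟩ := exists_average_eq k
    rw [cguAverage_eq, Matrix.mul_smul, Matrix.smul_mul, Matrix.mul_sum, Matrix.sum_mul]
    simp only [tensorPow_rot_mul, zero_add]
    rw [h n hn φ, ← h n hn 0]
    simp only [zero_add]
  calc cguAverage n k * tensorPow k (rot φ)
      = tensorPow k (rot φ) * cguAverage n k * (tensorPow k (rot φ))ᴴ * tensorPow k (rot φ) := by
        rw [hconj]
    _ = tensorPow k (rot φ) * cguAverage n k := by
        rw [mul_assoc, tensorPow_rot_conjTranspose_mul_self, mul_one]

theorem isGreatest_attainableProbs_cguCopies {n k : ℕ} (hn : k < n) :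
    IsGreatest (attainableProbs (cguCopies n k))
      ((matSqrt (cguAverage n k)).trace.re ^ 2 / n) := by
  refine isGreatest_attainableProbs (by omega) (cguCopies n k) (tensorPow k (angleState 0))
    (fun j => tensorPow k (rot (Real.pi * ((j : ℕ) + 1) / n))) (fun j => ?_) (fun j => ?_)
    (fun j => tensorPow_rot_conjTranspose_mul_self k _) (fun j => ?_) _ rfl
    fun j => commute_cguAverage_rot hn _
  · rw [cguCopies_eq, angleState, tensorPow_vecMulVec]
    have : (fun x : Fin k → Fin 2 => ∏ a, star (angleVec (Real.pi * ((j : ℕ) + 1) / n)) (x a)) =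
        star fun x : Fin k → Fin 2 => ∏ a, angleVec (Real.pi * ((j : ℕ) + 1) / n) (x a) := by
      ext x
      simp [Pi.star_apply]
    rw [this]
    exact Matrix.posSemidef_vecMulVec_self_star _
  · rw [cguCopies_eq, angleState, tensorPow_vecMulVec]
    exact isRankOneLike_vecMulVec _ _
  · rw [tensorPow_rot_mul, add_zero, cguCopies_eq]

theorem ofReal_re_trace_matSqrt {d : Type} [Fintype d] [DecidableEq d] (A : Matrix d d ℂ) :
    ((matSqrt A).trace.re : ℂ) = (matSqrt A).trace := by
  have h : (matSqrt A).PosSemidef := Matrix.nonneg_iff_posSemidef.mp (CFC.sqrt_nonneg A)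
  exact (Complex.eq_re_of_ofReal_le (r := 0) (by simpa using h.trace_nonneg)).symm

end MultiCopy

theorem mainTheorem10 :
    ∃ (ϱ : (k : ℕ) → Matrix (Fin k → Fin 2) (Fin k → Fin 2) ℂ) (f : ℕ → ℝ),
      (∀ k : ℕ, (f k : ℂ) = (MultiCopy.matSqrt (ϱ k)).trace ^ 2) ∧
      ∀ n k : ℕ, k < n →
        MultiCopy.cguAverage n k = ϱ k ∧
        IsGreatest (MultiCopy.attainableProbs (MultiCopy.cguCopies n k)) (MultiCopy.probCGU n k) ∧
        MultiCopy.probCGU n k = f k / (n : ℝ) := by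
  -- `k + 1` is the least admissible number of states.
  refine ⟨fun k => MultiCopy.cguAverage (k + 1) k,
    fun k => (MultiCopy.matSqrt (MultiCopy.cguAverage (k + 1) k)).trace.re ^ 2, fun k => ?_,
    fun n k hn => ?_⟩
  · rw [Complex.ofReal_pow, MultiCopy.ofReal_re_trace_matSqrt]
  · have havg := MultiCopy.cguAverage_eq_of_lt hn (Nat.lt_succ_self k)
    have hmax := MultiCopy.isGreatest_attainableProbs_cguCopies hn
    have hprob : MultiCopy.probCGU n k =
        (MultiCopy.matSqrt (MultiCopy.cguAverage n k)).trace.re ^ 2 / n := hmax.csSup_eq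
    refine ⟨havg, ?_, ?_⟩
    · rw [hprob]
      exact hmax
    · rw [hprob, havg]
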